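/- Consider a network with $B\ge 2$ base stations (BSs) $1,\dots,B$, where BS $i$ has $m_i\ge 1$ radio-frequency chains ($m_i$ an integer). Users arrive according to a Poisson process of rate $\lambda>0$; independently of everything else, an arriving user is located in the cell of BS $i$ with probability $p_i\ge 0$, where $\sum_{i=1}^B p_i=1$, and has a file whose size is exponentially distributed with parameter $\mu>0$. On arrival, each user associates with one BS, stays associated with it until its file is transmitted, and then leaves. A user located in the cell of BS $k$ has data rate $c_2$ if it associates with BS $k$ and data rate $c_1$ if it associates with any other BS, where $c_1=1<c_2$. If $X_i$ users are associated with BS $i$, each of them that has data rate $r$ is served with throughput $\min(m_i,X_i)\,r/X_i$. Let $X_{i1}$ and $X_{i2}$ be the numbers of users associated with BS $i$ at rates $c_1$ and $c_2$, so that $X_i=X_{i1}+X_{i2}$. Under the Load based policy, an arriving user joins a BS $i$ for which $X_i$ is minimum, ties being broken uniformly at random. The matrix $(X_{ir})_{1\le i\le B,\ r\in\{1,2\}}$ is then a continuous-time Markov chain; its state space is the set of all states that can be reached from the empty state, and on it the chain is irreducible. The system is called stable if this chain is positive recurrent, and unstable if it is null recurrent or transient. (a) If $c_2=2$ and $$\lambda\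 \ge\ \frac{2\mu\sum_{i=1}^B m_i}{2-\max(p_1,\dots,p_B)},$$ then under the Load based policy the system is unstable. (b) If $c_2=2$, $m_i=1$ for all $i$, and $\lambda<\mu$, then under the Load based policy the system is stable. -/

import Mathlib

open MeasureTheory ProbabilityTheory
open scoped ENNReal NNReal

/-! ## Continuous-time Markov chains on a countable state space -/

/-- The data of a continuous-time Markov chain without absorbing states: the total rate `rate s`
at which the chain leaves `s` and the law `jump s` of the state entered next. -/
structure MarkovJump (S : Type*) where
  rate : S → ℝ
  rate_pos : ∀ s, 0 < rate s
  jump : S → PMF S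

namespace MarkovJump

/-- Sample space of the jump-and-hold construction: the visited states, and the sequence of
normalised (mean one) holding times. -/
abbrev Sample (S : Type*) : Type _ := (ℕ → S) × (ℕ → ℝ)

section Chain

variable {S : Type*} [MeasurableSpace S] [MeasurableSingletonClass S] [Countable S]

/-- The transition kernels of the embedded discrete-time chain: the next state depends on the
history only through the current state. -/
noncomputable def kernel (D : MarkovJump S) (n : ℕ) : Kernel (Finset.Iic n → S) S :=
  Kernel.ofFunOfCountable fun h => (D.jump (h ⟨n, Finset.mem_Iic.2 le_rfl⟩)).toMeasure

instance (D : MarkovJump S) (n : ℕ) : IsMarkovKernel (D.kernel n) :=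
  ⟨fun _ => PMF.toMeasure.isProbabilityMeasure _⟩

/-- The law of the embedded discrete-time chain started at `x`. -/
noncomputable def embeddedLaw (D : MarkovJump S) (x : S) : Measure (ℕ → S) :=
  Kernel.trajMeasure (X := fun _ => S) (Measure.dirac x) D.kernel

/-- The law of the continuous-time chain started at `x`: the embedded chain together with an
independent sequence of i.i.d. exponential variables of parameter one. -/
noncomputable def law (D : MarkovJump S) (x : S) : Measure (Sample S) :=
  (D.embeddedLaw x).prod (Measure.infinitePi fun _ : ℕ => expMeasure 1)

end Chain

variable {S : Type*}

/-- The `n`-th holding time; given the visited states it is exponential with parameter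
`D.rate (ω.1 n)`. -/
noncomputable def holding (D : MarkovJump S) (n : ℕ) (ω : Sample S) : ℝ :=
  ω.2 n / D.rate (ω.1 n)

/-- The time of the `n`-th jump (with `jumpTime 0 = 0`). -/
noncomputable def jumpTime (D : MarkovJump S) (n : ℕ) (ω : Sample S) : ℝ :=
  ∑ k ∈ Finset.range n, D.holding k ω

/-- The continuous-time chain is in state `s` at time `t`. -/
def IsAt (D : MarkovJump S) (ω : Sample S) (t : ℝ≥0) (s : S) : Prop :=
  ∃ n, D.jumpTime n ω ≤ t ∧ (t : ℝ) < D.jumpTime (n + 1) ω ∧ ω.1 n = s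

/-- The first passage time to `s` at or after the first jump; started from `s` this is the return
time to `s`. It is `∞` if `s` is not visited any more. -/
noncomputable def returnTime (D : MarkovJump S) (s : S) (ω : Sample S) : ℝ≥0∞ :=
  ⨅ (t : ℝ≥0) (_ : D.jumpTime 1 ω ≤ t ∧ D.IsAt ω t s), (t : ℝ≥0∞)

/-- `y` can be reached from `x` by finitely many transitions of positive probability. -/
def Reaches (D : MarkovJump S) : S → S → Prop :=
  Relation.ReflTransGen fun a b => D.jump a b ≠ 0

variable [MeasurableSpace S] [MeasurableSingletonClass S] [Countable S]

/-- The state `s` is recurrent: started from `s`, the chain returns to `s` almost surely. -/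
def RecurrentAt (D : MarkovJump S) (s : S) : Prop :=
  D.law s {ω | D.returnTime s ω < ∞} = 1

/-- The state `s` is transient: the return probability is less than one. -/
def TransientAt (D : MarkovJump S) (s : S) : Prop :=
  D.law s {ω | D.returnTime s ω < ∞} < 1

/-- The state `s` is positive recurrent: recurrent with a finite mean return time. -/
def PositiveRecurrentAt (D : MarkovJump S) (s : S) : Prop :=
  D.RecurrentAt s ∧ ∫⁻ ω, D.returnTime s ω ∂(D.law s) < ∞

/-- The state `s` is null recurrent: recurrent with an infinite mean return time. -/
def NullRecurrentAt (D : MarkovJump S) (s : S) : Prop :=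
  D.RecurrentAt s ∧ ∫⁻ ω, D.returnTime s ω ∂(D.law s) = ∞

end MarkovJump

/-! ## The network -/

/-- A network with `B` base stations (BSs). File sizes are exponential with parameter `μ`, users
arrive at the epochs of a Poisson process of intensity `lam`, an arriving user is located in the
cell of BS `i` with probability `p i`, and BS `i` has `m i` radio frequency chains. A user is
served at data rate `c₂` by the BS of its own cell and at data rate `c₁` by any other BS. -/
structure Network (B : ℕ) where
  lam : ℝ
  μ : ℝ
  c₁ : ℝ
  c₂ : ℝ
  m : Fin B → ℕ
  p : Fin B → ℝ
  lam_pos : 0 < lam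
  μ_pos : 0 < μ
  c₁_pos : 0 < c₁
  c₁_lt_c₂ : c₁ < c₂
  one_le_m : ∀ i, 1 ≤ m i
  p_nonneg : ∀ i, 0 ≤ p i
  p_sum : ∑ i, p i = 1

/-- A state `s`: `s i 0` is the number of users associated with BS `i` at rate `c₁`, and `s i 1`
the number of users associated with BS `i` at rate `c₂`. -/
abbrev NetState (B : ℕ) : Type := Fin B → Fin 2 → ℕ

/-- The number of users associated with BS `i`. -/
def NetState.load {B : ℕ} (s : NetState B) (i : Fin B) : ℕ := s i 0 + s i 1

/-- An (online, possibly randomised) association policy: in state `s`, a user arriving in cell `k`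
chooses its BS according to the distribution `π s k`. -/
abbrev Policy (B : ℕ) : Type := NetState B → Fin B → PMF (Fin B)

/-- The BSs with the minimum number of already associated users. -/
def leastLoaded {B : ℕ} (s : NetState B) : Finset (Fin B) :=
  Finset.univ.filter fun i => ∀ j, NetState.load s i ≤ NetState.load s j

theorem leastLoaded_nonempty {B : ℕ} (s : NetState B) (k : Fin B) : (leastLoaded s).Nonempty := by
  obtain ⟨i, -, hi⟩ := Finset.exists_min_image Finset.univ (NetState.load s) ⟨k, Finset.mem_univ k⟩
  exact ⟨i, by simpa [leastLoaded] using hi⟩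

/-- The Load based policy: join a BS with the minimum number of already associated users, chosen
uniformly at random among them. -/
noncomputable def loadBased (B : ℕ) : Policy B := fun s k =>
  PMF.uniformOfFinset (leastLoaded s) (leastLoaded_nonempty s k)

/-- The type (`0` for rate `c₁`, `1` for rate `c₂`) of the link between a user located in cell `k`
and BS `i`. -/
def linkType {B : ℕ} (k i : Fin B) : Fin 2 := if k = i then 1 else 0

/-- The transitions: `Sum.inl (i, r)` is the arrival of a user that joins BS `i` with link type `r`,
and `Sum.inr (i, r)` is the departure of such a user. -/
abbrev NetEvent (B : ℕ) : Type := (Fin B × Fin 2) ⊕ (Fin B × Fin 2)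

/-- The state entered from `s` through an event. -/
def NetState.next {B : ℕ} (s : NetState B) : NetEvent B → NetState B
  | Sum.inl (i, r) => Function.update s i (Function.update (s i) r (s i r + 1))
  | Sum.inr (i, r) => Function.update s i (Function.update (s i) r (s i r - 1))

namespace Network

variable {B : ℕ} (N : Network B)

/-- The data rate of a link type. -/
def dataRate (r : Fin 2) : ℝ := if r = 0 then N.c₁ else N.c₂

/-- The probability that, in state `s`, a new user joins BS `i` with link type `r`. -/
noncomputable def joinProb (π : Policy B) (s : NetState B) (i : Fin B) (r : Fin 2) : ℝ :=
  ∑ k, if linkType k i = r then N.p k * (π s k i).toReal else 0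

/-- The rate of each transition in state `s`. The `s i r` users of BS `i` with link type `r` have
throughput `min (m i) (X i) * dataRate r / X i` each, where `X i` is the load of BS `i`; the rate is
`0` when `s i r = 0`. -/
noncomputable def eventRate (π : Policy B) (s : NetState B) : NetEvent B → ℝ
  | Sum.inl (i, r) => N.lam * N.joinProb π s i r
  | Sum.inr (i, r) =>
      N.μ * (s i r * (min (N.m i : ℝ) (NetState.load s i) * N.dataRate r / NetState.load s i))

/-- The total transition rate out of state `s`. -/
noncomputable def totalRate (π : Policy B) (s : NetState B) : ℝ :=
  ∑ e, N.eventRate π s e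

theorem dataRate_pos (r : Fin 2) : 0 < N.dataRate r := by
  unfold dataRate
  split_ifs
  · exact N.c₁_pos
  · exact N.c₁_pos.trans N.c₁_lt_c₂

theorem eventRate_nonneg (π : Policy B) (s : NetState B) (e : NetEvent B) :
    0 ≤ N.eventRate π s e := by
  rcases e with ⟨i, r⟩ | ⟨i, r⟩
  · refine mul_nonneg N.lam_pos.le (Finset.sum_nonneg fun k _ => ?_)
    split_ifs
    · exact mul_nonneg (N.p_nonneg k) ENNReal.toReal_nonneg
    · exact le_rfl
  · have h1 := N.μ_pos.le
    have h2 := (N.dataRate_pos r).le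
    have h3 : (0 : ℝ) ≤ min (N.m i : ℝ) (NetState.load s i) :=
      le_min (Nat.cast_nonneg _) (Nat.cast_nonneg _)
    simp only [eventRate]
    positivity

theorem sum_joinProb (π : Policy B) (s : NetState B) :
    ∑ i, ∑ r, N.joinProb π s i r = 1 := by
  have h (i : Fin B) : ∑ r, N.joinProb π s i r = ∑ k, N.p k * (π s k i).toReal := by
    unfold joinProb
    rw [Finset.sum_comm]
    exact Finset.sum_congr rfl fun k _ => by simp
  have h2 (k : Fin B) : ∑ i, (π s k i).toReal = 1 := by
    rw [← ENNReal.toReal_sum fun i _ => PMF.apply_ne_top _ _, ← tsum_fintype (L := .unconditional _),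
      PMF.tsum_coe, ENNReal.toReal_one]
  simp_rw [h]
  rw [Finset.sum_comm]
  simp_rw [← Finset.mul_sum, h2, mul_one, N.p_sum]

/-- The total transition rate is the arrival rate plus the departure rates of the BSs; the terms
with load zero vanish. -/
theorem totalRate_eq (π : Policy B) (s : NetState B) :
    N.totalRate π s = N.lam + ∑ i, N.μ * min (N.m i : ℝ) (NetState.load s i) *
      ((s i 0 * N.c₁ + s i 1 * N.c₂) / NetState.load s i) := by
  unfold totalRate
  rw [Fintype.sum_sum_type, Fintype.sum_prod_type, Fintype.sum_prod_type]
  congr 1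
  · simp only [eventRate, ← Finset.mul_sum, N.sum_joinProb, mul_one]
  · refine Finset.sum_congr rfl fun i _ => ?_
    rw [Fin.sum_univ_two]
    simp only [eventRate, dataRate]
    simp
    ring

theorem totalRate_pos (π : Policy B) (s : NetState B) : 0 < N.totalRate π s := by
  have h : N.lam ≤ N.totalRate π s := by
    unfold totalRate
    rw [Fintype.sum_sum_type, Fintype.sum_prod_type]
    have h1 : ∑ i, ∑ r, N.eventRate π s (Sum.inl (i, r)) = N.lam := by
      simp only [eventRate, ← Finset.mul_sum, N.sum_joinProb, mul_one]
    rw [h1]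
    exact le_add_of_nonneg_right (Finset.sum_nonneg fun e _ => N.eventRate_nonneg π s _)
  exact N.lam_pos.trans_le h

/-- In state `s`, the next transition is the event `e` with probability
`eventRate s e / totalRate s`. -/
noncomputable def eventLaw (π : Policy B) (s : NetState B) : PMF (NetEvent B) :=
  PMF.ofFintype (fun e => ENNReal.ofReal (N.eventRate π s e / N.totalRate π s)) (by
    rw [← ENNReal.ofReal_sum_of_nonneg fun e _ =>
      div_nonneg (N.eventRate_nonneg π s e) (N.totalRate_pos π s).le, ← Finset.sum_div]
    change ENNReal.ofReal (N.totalRate π s / N.totalRate π s) = 1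
    rw [div_self (N.totalRate_pos π s).ne', ENNReal.ofReal_one])

/-- The continuous-time Markov chain induced by an association policy. -/
noncomputable def chain (π : Policy B) : MarkovJump (NetState B) where
  rate := N.totalRate π
  rate_pos := N.totalRate_pos π
  jump s := (N.eventLaw π s).map (NetState.next s)

/-- The state space of the induced chain: the states that can occur in a network that starts with
no users. (If some `p i` is `0` or `1`, certain entries of the state always stay `0`.) The empty
state can be reached from every state, so the chain is irreducible on this set. -/
def stateSpace (π : Policy B) : Set (NetState B) :=
  {s | (N.chain π).Reaches 0 s}

/-- The system is stable: the induced chain is positive recurrent. -/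
def Stable (π : Policy B) : Prop :=
  ∀ s ∈ N.stateSpace π, (N.chain π).PositiveRecurrentAt s

/-- The system is unstable: the induced chain is null recurrent or transient. -/
def Unstable (π : Policy B) : Prop :=
  (∀ s ∈ N.stateSpace π, (N.chain π).NullRecurrentAt s) ∨
    (∀ s ∈ N.stateSpace π, (N.chain π).TransientAt s)

end Network

/-! Give a user weight 2 at rate 1 and weight 1 at rate 2. Weight times rate is then always 2, so BS
`i` drains weighted work at rate at most `2 * μ * m i` whatever its mix of users. Least-load
association ignores the user's cell, so an arrival gets rate 2 with probability at most `⨆ i, N.p i`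
and brings mean weight at least `2 - ⨆ i, N.p i`. In (a) the weighted count therefore has
nonnegative drift everywhere, and strictly positive drift in the empty state, where nothing is
served. At equality no more than this is available, so the argument has to allow null recurrence:
`tsum_survival_eq_top_of_drift` bounds the probability of no return in `n` steps below by a multiple
of `1 / n`, so the mean return time cannot be finite. Recurrence being a class property
(`escape_eq_zero_of_recurrent`), the chain is wholly null recurrent or wholly transient.

In (b) every nonempty state has a busy BS that completes files at rate at least `μ > λ`. The number
of users then has uniformly negative drift off the empty state, and Foster's criterion
(`tsum_survival_ne_top_of_drift`) applies.

Both criteria concern the embedded chain killed at `s`. `lintegral_avoiding` and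
`lintegral_returnTime` carry them to continuous time, where total rates bounded above and below make
mean time and mean number of steps comparable. -/

namespace MarkovJump

/-! ### Potential theory of the embedded chain killed at a state -/

section Killed

variable {S : Type*} (D : MarkovJump S)

/-- The transition operator of the embedded chain killed on entering `s`. -/
noncomputable def killed (s : S) (f : S → ℝ≥0∞) (x : S) : ℝ≥0∞ :=
  ∑' y, D.jump x y * ({s}ᶜ : Set S).indicator f y

/-- The probability that the embedded chain avoids `s` at the times `1, …, n`, as a function of
the initial state. -/
noncomputable def survival (s : S) (n : ℕ) : S → ℝ≥0∞ := (D.killed s)^[n] 1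

theorem killed_mono (s : S) : Monotone (D.killed s) := fun _ _ h _ =>
  ENNReal.tsum_le_tsum fun y => mul_le_mul_right (Set.indicator_le_indicator (h y)) _

theorem killed_add (s : S) (f g : S → ℝ≥0∞) :
    D.killed s (f + g) = D.killed s f + D.killed s g := by
  funext x
  simp only [killed, Pi.add_apply, ← ENNReal.tsum_add, ← mul_add, Set.indicator_add']

theorem killed_smul (s : S) (c : ℝ≥0∞) (f : S → ℝ≥0∞) :
    D.killed s (c • f) = c • D.killed s f := by
  funext x
  simp only [killed, Pi.smul_apply, smul_eq_mul, ← ENNReal.tsum_mul_left]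
  refine tsum_congr fun y => ?_
  by_cases hy : y = s
  · simp [hy]
  · simp [hy]; ring

theorem iterate_killed_mono (s : S) (n : ℕ) : Monotone (D.killed s)^[n] :=
  (D.killed_mono s).iterate n

theorem iterate_killed_add (s : S) (n : ℕ) (f g : S → ℝ≥0∞) :
    (D.killed s)^[n] (f + g) = (D.killed s)^[n] f + (D.killed s)^[n] g := by
  induction n generalizing f g with
  | zero => rfl
  | succ n ih => simp only [Function.iterate_succ_apply, killed_add, ih]

theorem iterate_killed_smul (s : S) (n : ℕ) (c : ℝ≥0∞) (f : S → ℝ≥0∞) :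
    (D.killed s)^[n] (c • f) = c • (D.killed s)^[n] f := by
  induction n generalizing f with
  | zero => rfl
  | succ n ih => simp only [Function.iterate_succ_apply, killed_smul, ih]

/-- The full transition operator splits into the killed one and the jumps into `s`. -/
theorem tsum_jump_mul (s x : S) (f : S → ℝ≥0∞) :
    ∑' y, D.jump x y * f y = D.killed s f x + D.jump x s * f s := by
  classical
  rw [killed, ← tsum_ite_eq s (fun y => D.jump x y * f y), ← ENNReal.tsum_add]
  refine tsum_congr fun y => ?_
  by_cases hy : y = s <;> simp [hy]

theorem killed_one_add (s x : S) : D.killed s 1 x + D.jump x s = 1 := by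
  have h := D.tsum_jump_mul s x 1
  simpa [PMF.tsum_coe] using h.symm

theorem killed_le_tsum (s x : S) (f : S → ℝ≥0∞) :
    D.killed s f x ≤ ∑' y, D.jump x y * f y := by
  rw [D.tsum_jump_mul s x f]; exact le_self_add

theorem mul_le_killed {s x y : S} (hy : y ≠ s) (f : S → ℝ≥0∞) :
    D.jump x y * f y ≤ D.killed s f x := by
  have h := ENNReal.le_tsum (f := fun y => D.jump x y * ({s}ᶜ : Set S).indicator f y) y
  simpa [hy, killed] using h

theorem killed_one_le (s : S) : D.killed s 1 ≤ 1 := fun x => by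
  rw [Pi.one_apply, ← D.killed_one_add s x]; exact le_self_add

theorem survival_succ (s : S) (n : ℕ) : D.survival s (n + 1) = D.killed s (D.survival s n) :=
  Function.iterate_succ_apply' _ _ _

theorem survival_antitone (s : S) : Antitone (D.survival s) :=
  antitone_nat_of_succ_le fun n => by
    rw [survival, Function.iterate_succ_apply]
    exact D.iterate_killed_mono s n (D.killed_one_le s)

theorem survival_le_one (s : S) (n : ℕ) (x : S) : D.survival s n x ≤ 1 :=
  D.survival_antitone s n.zero_le x

theorem survival_ne_top (s : S) (n : ℕ) (x : S) : D.survival s n x ≠ ∞ :=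
  ne_top_of_le_ne_top ENNReal.one_ne_top (D.survival_le_one s n x)

theorem killed_lt_one {s x y : S} {f : S → ℝ≥0∞} (hf : f ≤ 1) (hxy : D.jump x y ≠ 0)
    (hy : y = s ∨ f y < 1) : D.killed s f x < 1 := by
  rw [← (D.jump x).tsum_coe, killed]
  refine ENNReal.tsum_lt_tsum (i := y) (ne_top_of_le_ne_top ENNReal.one_ne_top
    ((D.killed_mono s hf x).trans (D.killed_one_le s x))) (fun z => ?_) ?_
  · refine mul_le_of_le_one_right' (Set.indicator_le_self' (fun _ _ => bot_le) z |>.trans (hf z))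
  · conv_rhs => rw [← mul_one (D.jump x y)]
    refine ENNReal.mul_lt_mul_right hxy ((D.jump x).apply_ne_top y) ?_
    rcases hy with rfl | hy
    · simp
    · exact (Set.indicator_le_self' (fun _ _ => bot_le) y).trans_lt hy

/-- Survival drops below one backwards along a path to `s`. The case `x = s` is excluded because the
path may then be empty, which says nothing about returning. -/
theorem exists_survival_lt_one {s x : S} (h : D.Reaches x s) (hx : x ≠ s) :
    ∃ n, D.survival s n x < 1 := by
  induction h using Relation.ReflTransGen.head_induction_on with
  | refl => exact absurd rfl hx
  | head hxy _ ih =>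
    rename_i a c _
    by_cases hc : c = s
    · exact ⟨1, D.killed_lt_one le_rfl hxy (Or.inl hc)⟩
    · obtain ⟨n, hn⟩ := ih hc
      refine ⟨n + 1, ?_⟩
      rw [survival_succ]
      exact D.killed_lt_one (D.survival_le_one s n) hxy (Or.inr hn)

/-- The expected number of visits to `z` before hitting `s` is finite if `z` leads to `s`. -/
theorem tsum_iterate_killed_indicator_ne_top {s z : S} (h : D.Reaches z s) (x : S) :
    ∑' n, (D.killed s)^[n] (({z} : Set S).indicator 1) x ≠ ∞ := by
  by_cases hz : z = s
  · subst hz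
    -- The killed operator ignores values at `s`, so for `z = s` only the term `n = 0` survives.
    have h0 : D.killed z (({z} : Set S).indicator 1) = 0 := by
      funext x
      rw [killed, Pi.zero_apply, ENNReal.tsum_eq_zero]
      intro y
      by_cases hy : y = z <;> simp [hy]
    have h00 : D.killed z 0 = 0 := by funext x; simp [killed]
    rw [tsum_eq_single 0]
    · exact ne_top_of_le_ne_top ENNReal.one_ne_top
        (Set.indicator_le_self' (fun _ _ => bot_le) x)
    · intro n hn
      obtain ⟨m, rfl⟩ := Nat.exists_eq_succ_of_ne_zero hn
      rw [Function.iterate_succ_apply, h0, Function.iterate_fixed h00]; rfl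
  obtain ⟨N, hN⟩ := D.exists_survival_lt_one h hz
  -- `v` is the probability of hitting `s` within `N` steps. Its iterates are differences of
  -- survivals with lag `N`, so they telescope to at most `N`, while `v` dominates `v z` times the
  -- indicator of `z`.
  set v : S → ℝ≥0∞ := fun y => 1 - D.survival s N y with hv
  have hv1 : v + D.survival s N = 1 := by
    funext y; exact tsub_add_cancel_of_le (D.survival_le_one s N y)
  have hstep (n : ℕ) : (D.killed s)^[n] v x + D.survival s (n + N) x = D.survival s n x := by
    rw [survival, Function.iterate_add_apply, ← Pi.add_apply, ← iterate_killed_add]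
    change (D.killed s)^[n] (v + D.survival s N) x = _
    rw [hv1]; rfl
  have hsum (M : ℕ) : ∑ n ∈ Finset.range M, (D.killed s)^[n] v x ≤ N := by
    have hfin : ∑ n ∈ Finset.range M, D.survival s (n + N) x ≠ ∞ :=
      ENNReal.sum_ne_top.2 fun n _ => D.survival_ne_top s _ x
    rw [← ENNReal.add_le_add_iff_right hfin, ← Finset.sum_add_distrib,
      Finset.sum_congr rfl fun n _ => hstep n]
    calc ∑ n ∈ Finset.range M, D.survival s n x
        ≤ ∑ n ∈ Finset.range (N + M), D.survival s n x :=
          Finset.sum_le_sum_of_subset (Finset.range_mono (by omega))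
      _ = ∑ n ∈ Finset.range N, D.survival s n x
          + ∑ n ∈ Finset.range M, D.survival s (n + N) x := by
          rw [Finset.sum_range_add]; simp only [add_comm N]
      _ ≤ _ := by
          gcongr
          calc _ ≤ ∑ n ∈ Finset.range N, (1 : ℝ≥0∞) :=
                Finset.sum_le_sum fun n _ => D.survival_le_one s n x
            _ = N := by simp
  have hδ : v z ≠ 0 := (tsub_pos_of_lt hN).ne'
  have hle : v z • (({z} : Set S).indicator (1 : S → ℝ≥0∞)) ≤ v := fun y => by
    by_cases hy : y = z <;> simp [hy]
  have htot : v z * ∑' n, (D.killed s)^[n] (({z} : Set S).indicator 1) x ≤ N := by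
    rw [← ENNReal.tsum_mul_left]
    refine ENNReal.tsum_le_of_sum_range_le fun M => (Finset.sum_le_sum fun n _ => ?_).trans (hsum M)
    have := D.iterate_killed_mono s n hle x
    rwa [iterate_killed_smul] at this
  intro htop
  rw [htop, ENNReal.mul_top hδ] at htot
  exact absurd htot (by simp)

/-- **Foster's criterion**, for the mean return time (in steps) of any state that can be reached
from the exceptional state `z`. -/
theorem tsum_survival_ne_top_of_drift {s z : S} (h : D.Reaches z s) {V : S → ℝ≥0∞} {ε b : ℝ≥0∞}
    (hV : ∀ x, V x ≠ ∞) (hε : ε ≠ 0) (hb : b ≠ ∞)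
    (hdrift : ∀ x, ∑' y, D.jump x y * V y + ε ≤ V x + b * ({z} : Set S).indicator 1 x) (x : S) :
    ∑' n, D.survival s n x ≠ ∞ := by
  have hstep : D.killed s V + ε • (1 : S → ℝ≥0∞) ≤ V + b • (({z} : Set S).indicator 1) :=
    fun y => by
      refine le_trans ?_ (hdrift y)
      simpa using add_le_add_left (D.killed_le_tsum s y V) ε
  -- The drift inequality summed along the killed chain; the visits to `z` paid for by `b` have
  -- finite expected number.
  have key (N : ℕ) : ε * ∑ k ∈ Finset.range N, D.survival s k x + (D.killed s)^[N] V x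
      ≤ V x + b * ∑ k ∈ Finset.range N, (D.killed s)^[k] (({z} : Set S).indicator 1) x := by
    induction N with
    | zero => simp
    | succ N ih =>
      have := D.iterate_killed_mono s N hstep x
      simp only [iterate_killed_add, iterate_killed_smul, Pi.add_apply, Pi.smul_apply,
        smul_eq_mul, ← Function.iterate_succ_apply] at this
      rw [Finset.sum_range_succ, Finset.sum_range_succ, mul_add, mul_add]
      calc _ = ε * ∑ k ∈ Finset.range N, D.survival s k x
            + ((D.killed s)^[N + 1] V x + ε * D.survival s N x) := by ring
        _ ≤ ε * ∑ k ∈ Finset.range N, D.survival s k x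
            + ((D.killed s)^[N] V x + b * (D.killed s)^[N] (({z} : Set S).indicator 1) x) := by
            exact add_le_add_right this _
        _ = (ε * ∑ k ∈ Finset.range N, D.survival s k x
            + (D.killed s)^[N] V x) + b * (D.killed s)^[N] (({z} : Set S).indicator 1) x := by ring
        _ ≤ _ := by rw [← add_assoc]; gcongr
  have htot : ε * ∑' k, D.survival s k x
      ≤ V x + b * ∑' k, (D.killed s)^[k] (({z} : Set S).indicator 1) x := by
    rw [← ENNReal.tsum_mul_left]
    refine ENNReal.tsum_le_of_sum_range_le fun N => ?_
    rw [← Finset.mul_sum]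
    refine le_self_add.trans ((key N).trans ?_)
    gcongr
    exact ENNReal.sum_le_tsum _
  intro htop
  rw [htop, ENNReal.mul_top hε, top_le_iff] at htot
  exact ENNReal.add_ne_top.2 ⟨hV x, ENNReal.mul_ne_top hb
    (D.tsum_iterate_killed_indicator_ne_top h x)⟩ htot

/-- The probability that the embedded chain never visits `s` at a positive time. -/
noncomputable def escape (s x : S) : ℝ≥0∞ := ⨅ n, D.survival s n x

theorem escape_le_one (s x : S) : D.escape s x ≤ 1 := (iInf_le _ 0).trans le_rfl

theorem escape_eq_zero_of_tsum_ne_top {s x : S} (h : ∑' n, D.survival s n x ≠ ∞) :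
    D.escape s x = 0 := by
  refine iInf_eq_of_forall_ge_of_forall_gt_exists_lt (fun _ => bot_le) fun w hw => ?_
  exact ((ENNReal.tendsto_atTop_zero_of_tsum_ne_top h).eventually_lt_const hw).exists

/-- Pass to the limit in `survival_succ`: the sum is an integral for counting measure, dominated by
the jump probabilities. -/
theorem killed_escape (s : S) : D.killed s (D.escape s) = D.escape s := by
  funext x
  have hlim (y : S) : Filter.Tendsto (fun n => D.survival s n y) Filter.atTop
      (nhds (D.escape s y)) :=
    tendsto_atTop_iInf fun _ _ h => D.survival_antitone s h y
  have h1 : Filter.Tendsto (fun n => D.survival s (n + 1) x) Filter.atTop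
      (nhds (D.killed s (D.escape s) x)) := by
    simp only [survival_succ, killed]
    let _ : MeasurableSpace S := ⊤
    simp only [← lintegral_count]
    refine tendsto_lintegral_of_dominated_convergence (fun y => D.jump x y)
      (fun n => measurable_from_top) (fun n => .of_forall fun y => ?_) ?_
      (.of_forall fun y => ?_)
    · refine mul_le_of_le_one_right' ?_
      exact (Set.indicator_le_self' (fun _ _ => bot_le) y).trans (D.survival_le_one s n y)
    · rw [lintegral_count, PMF.tsum_coe]; exact ENNReal.one_ne_top
    · refine ENNReal.Tendsto.const_mul ?_ (Or.inr ((D.jump x).apply_ne_top y))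
      by_cases hy : y = s
      · simp [hy]
      · simpa [hy] using hlim y
  exact tendsto_nhds_unique h1 ((Filter.tendsto_add_atTop_iff_nat 1).2 (hlim x))

/-- A nonnegative fixed point of the killed operator that vanishes at a state vanishes at each
possible successor other than `s`. -/
theorem escape_eq_zero_of_reaches {s x : S} (hs : D.escape s s = 0) (h : D.Reaches s x) :
    D.escape s x = 0 := by
  induction h with
  | refl => exact hs
  | tail _ hbc ih =>
    rename_i b c _
    by_cases hc : c = s
    · rwa [hc]
    · rw [← D.killed_escape s] at ih
      have := (D.mul_le_killed hc (D.escape s) (x := b)).trans_eq ih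
      simpa [hbc] using this

theorem Reaches.trans {D : MarkovJump S} {x y z : S} (h₁ : D.Reaches x y) (h₂ : D.Reaches y z) :
    D.Reaches x z := Relation.ReflTransGen.trans h₁ h₂

/-- Recurrence (of the embedded chain) is a class property. -/
theorem escape_eq_zero_of_recurrent {s t : S} (hs : D.escape s s = 0) (hst : D.Reaches s t) :
    D.escape t t = 0 := by
  by_cases hne : s = t
  · rwa [← hne]
  -- Either `s` is avoided for `n` steps, or the chain restarts from `s` and must still avoid `t`.
  have hbound (n : ℕ) (x : S) : D.escape t x ≤ D.survival s n x + D.escape t s := by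
    induction n generalizing x with
    | zero => exact (D.escape_le_one t x).trans le_self_add
    | succ n ih =>
      calc D.escape t x ≤ ∑' y, D.jump x y * D.escape t y := by
            conv_lhs => rw [← D.killed_escape t]
            exact D.killed_le_tsum t x _
        _ = D.killed s (D.escape t) x + D.jump x s * D.escape t s := D.tsum_jump_mul s x _
        _ ≤ D.killed s (D.survival s n + D.escape t s • 1) x + D.jump x s * D.escape t s := by
            gcongr
            exact D.killed_mono s (fun y => by simpa using ih y) x
        _ = D.survival s (n + 1) x
            + D.escape t s * (D.killed s 1 x + D.jump x s) := by
            rw [killed_add, killed_smul, ← survival_succ]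
            simp only [Pi.add_apply, Pi.smul_apply, smul_eq_mul]; ring
        _ = _ := by rw [killed_one_add, mul_one]
  -- As `s` is recurrent, the survival term tends to zero: `s` maximises `escape t` over its
  -- reachable states. Iterating the fixed point equation from this maximum makes it strictly
  -- smaller at `s`, unless it is zero.
  have hmax (x : S) (hx : D.Reaches s x) : D.escape t x ≤ D.escape t s := by
    calc D.escape t x ≤ ⨅ n, (D.survival s n x + D.escape t s) := le_iInf fun n => hbound n x
      _ = D.escape s x + D.escape t s := ENNReal.iInf_add.symm
      _ = D.escape t s := by rw [D.escape_eq_zero_of_reaches hs hx, zero_add]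
  have hiter (n : ℕ) (x : S) (hx : D.Reaches s x) :
      D.escape t x ≤ D.escape t s * D.survival t n x := by
    induction n generalizing x with
    | zero => simpa [survival] using hmax x hx
    | succ n ih =>
      rw [← smul_eq_mul, survival_succ, ← Pi.smul_apply, ← killed_smul, ← D.killed_escape t]
      refine ENNReal.tsum_le_tsum fun y => ?_
      by_cases hxy : D.jump x y = 0
      · simp [hxy]
      · rw [D.killed_escape t]
        refine mul_le_mul_right (Set.indicator_le_indicator ?_) _
        exact ih y (hx.tail hxy)
  obtain ⟨N, hN⟩ := D.exists_survival_lt_one hst hne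
  have h0 : D.escape t s = 0 := by
    by_contra hpos
    have hlt : D.escape t s * D.survival t N s < D.escape t s := by
      conv_rhs => rw [← mul_one (D.escape t s)]
      exact ENNReal.mul_lt_mul_right hpos
        (ne_top_of_le_ne_top ENNReal.one_ne_top (D.escape_le_one t s)) hN
    exact absurd (hiter N s Relation.ReflTransGen.refl) hlt.not_ge
  exact le_antisymm ((hmax t hst).trans_eq h0) bot_le

/-- A function with bounded upward jumps and nonnegative drift, with an excess of drift `g` that is
seen before the return to `s` with positive probability, forces an infinite mean return time. -/
theorem tsum_survival_eq_top_of_drift {s : S} {V g : S → ℝ≥0∞} {c : ℝ≥0∞} (hc : c ≠ ∞)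
    (hV : ∀ x, V x ≠ ∞) (hdrift : ∀ x, V x + g x ≤ ∑' y, D.jump x y * V y)
    (hjump : ∀ x y, D.jump x y ≠ 0 → V y ≤ V x + c) {j : ℕ}
    (hg : (D.killed s)^[j] g s ≠ 0) :
    ∑' n, D.survival s n s = ∞ := by
  -- Subtraction-free form of `(V - V s) + g ≤ killed (V - V s)`.
  have hstep : V + g + V s • D.killed s 1 ≤ D.killed s V + V s • 1 := fun y => by
    simp only [Pi.add_apply, Pi.smul_apply, smul_eq_mul, Pi.one_apply]
    calc _ ≤ ∑' z, D.jump y z * V z + V s * D.killed s 1 y := by gcongr; exact hdrift y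
      _ = D.killed s V y + V s * (D.killed s 1 y + D.jump y s) := by
        rw [D.tsum_jump_mul s]; ring
      _ = _ := by rw [killed_one_add]
  have hlow (n : ℕ) : ∑ k ∈ Finset.range n, (D.killed s)^[k] g s + V s + V s * D.survival s n s
      ≤ (D.killed s)^[n] V s + V s := by
    induction n with
    | zero => simp [survival]
    | succ n ih =>
      have h1 := D.iterate_killed_mono s n hstep s
      simp only [iterate_killed_add, iterate_killed_smul, Pi.add_apply, Pi.smul_apply,
        smul_eq_mul, ← Function.iterate_succ_apply] at h1
      change _ + V s * D.survival s (n + 1) s ≤ _ + V s * D.survival s n s at h1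
      have hfin : V s * D.survival s n s ≠ ∞ := ENNReal.mul_ne_top (hV s) (D.survival_ne_top s n s)
      rw [← ENNReal.add_le_add_iff_right hfin, Finset.sum_range_succ]
      -- Cancelling the iterate requires it to be finite; if it is infinite, so is the next one, and
      -- the bound is trivial.
      have hVfin : (D.killed s)^[n] V s ≠ ∞ ∨ (D.killed s)^[n] V s = ∞ := (em _).symm
      rcases hVfin with hVfin | hVfin
      · rw [← ENNReal.add_le_add_iff_right hVfin]
        calc _ = (∑ k ∈ Finset.range n, (D.killed s)^[k] g s + V s + V s * D.survival s n s)
              + ((D.killed s)^[n] V s + (D.killed s)^[n] g s + V s * D.survival s (n + 1) s) := by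
              ring
          _ ≤ ((D.killed s)^[n] V s + V s)
              + ((D.killed s)^[n + 1] V s + V s * D.survival s n s) := by gcongr
          _ = _ := by ring
      · rw [hVfin, top_add, top_add, top_le_iff] at h1
        have : (D.killed s)^[n + 1] V s = ∞ := by
          by_contra hne
          exact ENNReal.add_ne_top.2 ⟨hne, hfin⟩ h1
        simp [this]
  have hup (n : ℕ) (x : S) : (D.killed s)^[n] V x ≤ (V x + n * c) * D.survival s n x := by
    induction n generalizing x with
    | zero => simp [survival]
    | succ n ih =>
      rw [Function.iterate_succ_apply', survival_succ, killed, killed, ← ENNReal.tsum_mul_left]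
      refine ENNReal.tsum_le_tsum fun y => ?_
      by_cases hxy : D.jump x y = 0
      · simp [hxy]
      by_cases hy : y = s
      · simp [hy]
      · simp only [Set.mem_compl_iff, Set.mem_singleton_iff, hy, not_false_iff,
          Set.indicator_of_mem]
        calc _ ≤ D.jump x y * ((V x + c + n * c) * D.survival s n y) := by
              gcongr
              refine (ih y).trans ?_
              gcongr
              exact hjump x y hxy
          _ = _ := by push_cast; ring
  -- Surviving paths have gained at most `n * c`, yet their mean gain is at least the accumulated
  -- excess. Once `n > j` this keeps survival above `a / (n * c)`, and the harmonic series diverges.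
  have hmain (n : ℕ) : ∑ k ∈ Finset.range n, (D.killed s)^[k] g s ≤ n * c * D.survival s n s := by
    have h := (hlow n).trans (add_le_add_left (hup n s) _)
    have hfin : V s + V s * D.survival s n s ≠ ∞ :=
      ENNReal.add_ne_top.2 ⟨hV s, ENNReal.mul_ne_top (hV s) (D.survival_ne_top s n s)⟩
    rw [← ENNReal.add_le_add_iff_right hfin]
    calc _ = _ := by rw [← add_assoc]
      _ ≤ _ := h
      _ = _ := by ring
  set a := (D.killed s)^[j] g s with ha
  have hlast (n : ℕ) (hn : j < n) : a ≤ n * c * D.survival s n s :=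
    (Finset.single_le_sum (f := fun k => (D.killed s)^[k] g s) (fun _ _ => bot_le)
      (Finset.mem_range.2 hn)).trans (hmain n)
  by_contra htop
  have hharm : ∑' n : ℕ, a * (((n + j + 1 : ℕ) : ℝ≥0∞))⁻¹ ≤ c * ∑' n, D.survival s n s := by
    rw [← ENNReal.tsum_mul_left]
    calc _ ≤ ∑' n, c * D.survival s (n + j + 1) s := by
          refine ENNReal.tsum_le_tsum fun n => ?_
          rw [← div_eq_mul_inv, ENNReal.div_le_iff (by simp) (ENNReal.natCast_ne_top _)]
          exact (hlast (n + j + 1) (by omega)).trans_eq (by ring)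
      _ ≤ _ := ENNReal.tsum_comp_le_tsum_of_injective (f := fun n => n + j + 1)
          (fun _ _ h => by simpa using h) (fun n => c * D.survival s n s)
  have hdiv : ∑' n : ℕ, (((n + j + 1 : ℕ) : ℝ≥0∞))⁻¹ = ∞ := by
    by_contra hne
    have h1 := ENNReal.summable_toReal hne
    simp only [ENNReal.toReal_inv, ENNReal.toReal_natCast] at h1
    exact Real.not_summable_natCast_inv ((summable_nat_add_iff (j + 1)).1
      (by simpa only [add_assoc] using h1))
  rw [ENNReal.tsum_mul_left, hdiv, ENNReal.mul_top hg, top_le_iff] at hharm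
  exact ENNReal.mul_ne_top hc htop hharm

end Killed

end MarkovJump

namespace MarkovJump

/-! ### Return times along a single trajectory -/

section Paths

variable {S : Type*} (D : MarkovJump S)

/-- The trajectories that avoid `s` at the times `1, …, n`. -/
def avoiding (s : S) (n : ℕ) : Set (ℕ → S) := {ω | ∀ k, 1 ≤ k → k ≤ n → ω k ≠ s}

variable {D} in
theorem strictMono_jumpTime {ω : Sample S} (h : ∀ n, 0 < ω.2 n) :
    StrictMono fun n => D.jumpTime n ω := by
  refine strictMono_nat_of_lt_succ fun n => ?_
  simp only [jumpTime, Finset.sum_range_succ]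
  exact lt_add_of_pos_right _ (div_pos (h n) (D.rate_pos _))

theorem returnTime_eq_top {ω : Sample S} {s : S} (hs : ∀ n, 1 ≤ n → ω.1 n ≠ s) :
    D.returnTime s ω = ∞ := by
  simp only [returnTime, iInf_eq_top, ENNReal.coe_ne_top, imp_false]
  rintro t ⟨h1, n, hn1, hn2, hn3⟩
  rcases Nat.eq_zero_or_pos n with rfl | hn
  · exact absurd h1 (not_le.2 hn2)
  · exact hs n hn hn3

theorem returnTime_eq_jumpTime {ω : Sample S} (h : ∀ n, 0 < ω.2 n) {s : S} {n : ℕ} (hn : 1 ≤ n)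
    (hns : ω.1 n = s) (hmin : ∀ k, 1 ≤ k → k < n → ω.1 k ≠ s) :
    D.returnTime s ω = ENNReal.ofReal (D.jumpTime n ω) := by
  have hmono := strictMono_jumpTime (D := D) h
  have h0 : 0 ≤ D.jumpTime n ω := by
    have := hmono.monotone (Nat.zero_le n)
    simpa [jumpTime] using this
  refine le_antisymm ?_ ?_
  · refine iInf₂_le (D.jumpTime n ω).toNNReal ?_
    simp only [IsAt, Real.coe_toNNReal _ h0]
    exact ⟨hmono.monotone hn, n, le_rfl, hmono n.lt_succ_self, hns⟩
  · refine le_iInf₂ fun t ht => ?_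
    obtain ⟨h1, k, hk1, hk2, hk3⟩ := ht
    have hk : 1 ≤ k := by
      by_contra hk
      obtain rfl : k = 0 := by omega
      exact absurd h1 (not_le.2 hk2)
    have hnk : n ≤ k := by
      by_contra hlt
      exact hmin k hk (not_le.1 hlt) hk3
    rw [ENNReal.ofReal_le_iff_le_toReal ENNReal.coe_ne_top]
    exact (hmono.monotone hnk).trans hk1

/-- Each term is a function of the visited states times a normalised holding time, so independence
lets the mean be computed termwise. The term `k = 0` always counts, since `avoiding s 0` is
everything. -/
theorem returnTime_eq_tsum {ω : Sample S} (h : ∀ n, 0 < ω.2 n) {s : S}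
    (hs : ∃ n, 1 ≤ n ∧ ω.1 n = s) :
    D.returnTime s ω = ∑' k, ((avoiding s k).indicator 1 ω.1 * ENNReal.ofReal (D.rate (ω.1 k))⁻¹)
      * ENNReal.ofReal (ω.2 k) := by
  classical
  obtain ⟨hn1, hn2⟩ := Nat.find_spec hs
  set n := Nat.find hs
  have hmin (k : ℕ) (h1 : 1 ≤ k) (hk : k < n) : ω.1 k ≠ s := fun h2 => Nat.find_min hs hk ⟨h1, h2⟩
  have hav (k : ℕ) : ω.1 ∈ avoiding s k ↔ k < n :=
    ⟨fun hk => not_le.1 fun hnk => hk n hn1 hnk hn2, fun hk j h1 h2 => hmin j h1 (by omega)⟩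
  have hnn (k : ℕ) : 0 ≤ D.holding k ω := div_nonneg (h k).le (D.rate_pos _).le
  rw [D.returnTime_eq_jumpTime h hn1 hn2 hmin, jumpTime, ENNReal.ofReal_sum_of_nonneg
    fun k _ => hnn k, tsum_eq_sum (s := Finset.range n)]
  · refine Finset.sum_congr rfl fun k hk => ?_
    rw [Set.indicator_of_mem ((hav k).2 (Finset.mem_range.1 hk)), Pi.one_apply, one_mul, holding,
      div_eq_mul_inv, ENNReal.ofReal_mul (h k).le, mul_comm]
  · intro k hk
    rw [Set.indicator_of_notMem (mt (hav k).1 (mt Finset.mem_range.2 hk))]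
    simp

end Paths

/-! ### From the killed operator to the law of the continuous-time chain -/

section Law

variable {S : Type*} [MeasurableSpace S] [MeasurableSingletonClass S] [Countable S]
  (D : MarkovJump S)

instance (x : S) : IsProbabilityMeasure (D.embeddedLaw x) := by
  unfold embeddedLaw; infer_instance

instance : IsProbabilityMeasure (expMeasure 1) := isProbabilityMeasure_expMeasure one_pos

instance (x : S) : IsProbabilityMeasure (D.law x) := by
  unfold law; infer_instance

theorem lintegral_embeddedLaw_zero (x : S) (f : S → ℝ≥0∞) :
    ∫⁻ ω, f (ω 0) ∂(D.embeddedLaw x) = f x := by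
  rw [embeddedLaw, Kernel.trajMeasure, Measure.map_dirac' (by fun_prop),
    Measure.dirac_bind (Kernel.measurable _)]
  have hm : Measurable fun ω : ℕ → S => f (ω 0) :=
    (measurable_of_countable f).comp (measurable_pi_apply 0)
  refine (Kernel.lintegral_traj _ hm).trans ?_
  simp [Function.updateFinset, MeasurableEquiv.piUnique]

/-- The Markov property: history and next state have as joint law the composition product with
`D.kernel n`. -/
theorem lintegral_embeddedLaw_succ (x : S) (n : ℕ) (f : S → ℝ≥0∞)
    {F : (Finset.Iic n → S) → ℝ≥0∞} (hF : Measurable F) :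
    ∫⁻ ω, F (Preorder.frestrictLe n ω) * f (ω (n + 1)) ∂(D.embeddedLaw x)
      = ∫⁻ ω, F (Preorder.frestrictLe n ω) * ∑' y, D.jump (ω n) y * f y ∂(D.embeddedLaw x) := by
  have hf : Measurable f := measurable_of_countable f
  have h := Kernel.map_frestrictLe_trajMeasure_compProd_eq_map_trajMeasure
    (X := fun _ => S) (μ₀ := Measure.dirac x) (κ := D.kernel) (a := n)
  have hFf : Measurable fun z : (Finset.Iic n → S) × S => F z.1 * f z.2 := by fun_prop
  have h1 := lintegral_map (μ := D.embeddedLaw x) hFf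
    (g := fun ω => (Preorder.frestrictLe n ω, ω (n + 1))) (by fun_prop)
  rw [← h1, embeddedLaw, ← h, Measure.lintegral_compProd hFf,
    lintegral_map hFf.lintegral_kernel_prod_right' (by fun_prop)]
  refine lintegral_congr fun ω => ?_
  dsimp only
  rw [lintegral_const_mul _ hf, lintegral_countable']
  simp only [kernel, Kernel.ofFunOfCountable]
  congr 1
  refine tsum_congr fun y => ?_
  rw [mul_comm]
  congr 1
  exact PMF.toMeasure_apply_singleton _ _ (measurableSet_singleton y)

theorem measurableSet_avoiding (s : S) (n : ℕ) : MeasurableSet (avoiding s n) := by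
  simp only [avoiding, Set.ofPred_forall]
  refine .iInter fun k => .iInter fun _ => .iInter fun _ => ?_
  exact measurableSet_eq_fun (measurable_pi_apply k) measurable_const |>.compl

/-- The bridge from operators to paths. The last step is absorbed into `f`, hence the induction over
all `f`. -/
theorem lintegral_avoiding (x s : S) (n : ℕ) (f : S → ℝ≥0∞) :
    ∫⁻ ω, (avoiding s n).indicator 1 ω * f (ω n) ∂(D.embeddedLaw x)
      = (D.killed s)^[n] f x := by
  induction n generalizing f with
  | zero =>
    have : avoiding s 0 = Set.univ := by
      ext; simp only [avoiding, Set.mem_ofPred_eq, Set.mem_univ, iff_true]; omega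
    simp [this, lintegral_embeddedLaw_zero]
  | succ n ih =>
    rw [Function.iterate_succ_apply, ← ih]
    -- The avoidance event as a set of histories, the form the Markov property requires.
    set A : Set (Finset.Iic n → S) := {h | ∀ k (hk : k ≤ n), 1 ≤ k → h ⟨k, Finset.mem_Iic.2 hk⟩ ≠ s}
      with hA
    have hAm : MeasurableSet A := by
      simp only [hA, Set.ofPred_forall]
      refine .iInter fun k => .iInter fun _ => .iInter fun _ => ?_
      exact measurableSet_eq_fun (measurable_pi_apply _) measurable_const |>.compl
    have hAn (ω : ℕ → S) : (avoiding s n).indicator (1 : (ℕ → S) → ℝ≥0∞) ω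
        = A.indicator 1 (Preorder.frestrictLe n ω) := by
      have : ω ∈ avoiding s n ↔ Preorder.frestrictLe n ω ∈ A := by
        simp only [avoiding, hA, Set.mem_ofPred_eq, Preorder.frestrictLe_apply]
        exact ⟨fun h k hk h1 => h k h1 hk, fun h k h1 hk => h k hk h1⟩
      by_cases hω : ω ∈ avoiding s n
      · rw [Set.indicator_of_mem hω, Set.indicator_of_mem (this.1 hω)]; rfl
      · rw [Set.indicator_of_notMem hω, Set.indicator_of_notMem (mt this.2 hω)]
    have hsucc (ω : ℕ → S) : (avoiding s (n + 1)).indicator (1 : (ℕ → S) → ℝ≥0∞) ω * f (ω (n + 1))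
        = A.indicator 1 (Preorder.frestrictLe n ω) * ({s}ᶜ : Set S).indicator f (ω (n + 1)) := by
      rw [← hAn]
      have : ω ∈ avoiding s (n + 1) ↔ ω ∈ avoiding s n ∧ ω (n + 1) ≠ s := by
        refine ⟨fun h => ⟨fun k h1 h2 => h k h1 (by omega), h _ (by omega) le_rfl⟩,
          fun h k h1 h2 => ?_⟩
        rcases h2.lt_or_eq with h3 | rfl
        · exact h.1 k h1 (by omega)
        · exact h.2
      by_cases h1 : ω ∈ avoiding s n <;> by_cases h2 : ω (n + 1) = s <;> simp [this, h1, h2]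
    simp only [hsucc]
    rw [D.lintegral_embeddedLaw_succ x n _ (measurable_one.indicator hAm)]
    simp only [hAn, killed]

theorem embeddedLaw_avoiding (x s : S) (n : ℕ) :
    D.embeddedLaw x (avoiding s n) = D.survival s n x := by
  rw [survival, ← lintegral_avoiding, ← lintegral_indicator_one (measurableSet_avoiding s n)]
  simp

theorem embeddedLaw_forall_ne (x s : S) :
    D.embeddedLaw x (⋂ n, avoiding s n) = D.escape s x := by
  have hanti : Antitone (avoiding s) := fun i j h ω hω k h1 h2 => hω k h1 (h2.trans h)
  rw [hanti.measure_iInter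
    (fun n => (measurableSet_avoiding s n).nullMeasurableSet) ⟨0, measure_ne_top _ _⟩]
  simp only [embeddedLaw_avoiding, escape]

/-- The mean of the exponential law of parameter one. -/
noncomputable def expMean : ℝ≥0∞ := ∫⁻ t, ENNReal.ofReal t ∂(expMeasure 1)

theorem ae_expMeasure_pos : ∀ᵐ t ∂(expMeasure 1), 0 < t := by
  have h := cdf_expMeasure_eq one_pos 0
  simp only [le_refl, if_true, mul_zero, neg_zero, Real.exp_zero, sub_self] at h
  rw [cdf_eq_real, measureReal_eq_zero_iff] at h
  rw [ae_iff]
  simpa [Set.Iic] using h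

theorem expMean_ne_zero : expMean ≠ 0 := by
  intro h
  rw [expMean, lintegral_eq_zero_iff (by fun_prop)] at h
  have : ∀ᵐ t ∂(expMeasure 1), False := by
    filter_upwards [h, ae_expMeasure_pos] with t h1 h2
    simp only [Pi.zero_apply, ENNReal.ofReal_eq_zero] at h1
    linarith
  exact this.exists.elim fun _ h => h

theorem expMean_ne_top : expMean ≠ ∞ := by
  have hint : IntegrableOn (fun t : ℝ => Real.exp (-t) * t ^ ((2 : ℝ) - 1)) (Set.Ioi 0) :=
    Real.GammaIntegral_convergent two_pos
  have h : expMean ≤ ∫⁻ t in Set.Ioi 0,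
      ENNReal.ofReal (Real.exp (-t) * t ^ ((2 : ℝ) - 1)) := by
    rw [expMean, expMeasure, gammaMeasure, lintegral_withDensity_eq_lintegral_mul _
      (f := gammaPDF 1 1) (measurable_gammaPDFReal 1 1).ennreal_ofReal (by fun_prop),
      ← lintegral_indicator measurableSet_Ioi]
    refine lintegral_mono fun t => ?_
    change exponentialPDF 1 t * ENNReal.ofReal t ≤ _
    by_cases ht : 0 < t
    · rw [Set.indicator_of_mem (Set.mem_Ioi.2 ht), exponentialPDF_of_nonneg ht.le,
        ← ENNReal.ofReal_mul (by positivity)]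
      norm_num
    · rw [ENNReal.ofReal_of_nonpos (not_lt.1 ht), mul_zero]; exact bot_le
  refine ne_top_of_le_ne_top ?_ h
  exact hint.lintegral_lt_top.ne

theorem ae_holding_pos (x : S) : ∀ᵐ ω ∂(D.law x), ∀ n, 0 < ω.2 n := by
  have h : ∀ᵐ e ∂(Measure.infinitePi fun _ : ℕ => expMeasure 1), ∀ n, 0 < e n :=
    ae_all_iff.2 fun n =>
      (measurePreserving_eval_infinitePi (fun _ : ℕ => expMeasure 1) n).quasiMeasurePreserving.ae
        ae_expMeasure_pos
  exact (Measure.quasiMeasurePreserving_snd (μ := D.embeddedLaw x)).ae h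

/-- When all holding times are positive, the return time is finite exactly when the embedded chain
returns: a return after finitely many jumps takes finite time. -/
theorem law_returnTime_lt_top (x s : S) :
    D.law x {ω | D.returnTime s ω < ∞} = 1 - D.escape s x := by
  have hm : MeasurableSet (⋂ n, avoiding s n) := .iInter fun n => measurableSet_avoiding s n
  have h : {ω | D.returnTime s ω < ∞} =ᵐ[D.law x] (⋂ n, avoiding s n)ᶜ ×ˢ Set.univ := by
    filter_upwards [D.ae_holding_pos x] with ω hω
    apply propext
    change D.returnTime s ω < ∞ ↔ ω ∈ (⋂ n, avoiding s n)ᶜ ×ˢ (Set.univ : Set (ℕ → ℝ))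
    simp only [Set.mem_prod, Set.mem_compl_iff, Set.mem_iInter, Set.mem_univ, and_true]
    constructor
    · intro hlt hall
      exact hlt.ne (D.returnTime_eq_top fun n hn => hall n n hn le_rfl)
    · intro hnot
      rw [lt_top_iff_ne_top]
      by_contra htop
      refine hnot fun n k h1 _ hk => ?_
      classical
      have hs : ∃ n, 1 ≤ n ∧ ω.1 n = s := ⟨k, h1, hk⟩
      rw [D.returnTime_eq_jumpTime hω (Nat.find_spec hs).1 (Nat.find_spec hs).2
        fun j hj1 hj2 hj3 => Nat.find_min hs hj2 ⟨hj1, hj3⟩] at htop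
      exact ENNReal.ofReal_ne_top htop
  rw [measure_congr h, law, Measure.prod_prod, measure_univ, mul_one, prob_compl_eq_one_sub hm,
    embeddedLaw_forall_ne]

theorem recurrentAt_iff (s : S) : D.RecurrentAt s ↔ D.escape s s = 0 := by
  rw [RecurrentAt, law_returnTime_lt_top]
  constructor
  · intro h
    have h1 : 1 - D.escape s s + D.escape s s = 1 := tsub_add_cancel_of_le (D.escape_le_one s s)
    rw [h] at h1
    exact (ENNReal.add_right_inj ENNReal.one_ne_top).1 (h1.trans (add_zero 1).symm)
  · intro h; simp [h]

theorem transientAt_iff (s : S) : D.TransientAt s ↔ D.escape s s ≠ 0 := by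
  rw [TransientAt, law_returnTime_lt_top, Ne, ← recurrentAt_iff, RecurrentAt,
    law_returnTime_lt_top]
  exact lt_iff_le_and_ne.trans (and_iff_right tsub_le_self)

/-- Tonelli applied to `returnTime_eq_tsum`. Of `expMean` only `expMean_ne_zero` and
`expMean_ne_top` are needed later. -/
theorem lintegral_returnTime {s : S} (hs : D.escape s s = 0) :
    ∫⁻ ω, D.returnTime s ω ∂(D.law s)
      = (∑' n, (D.killed s)^[n] (fun y => ENNReal.ofReal (D.rate y)⁻¹) s) * expMean := by
  have hae : ∀ᵐ ω ∂(D.law s), ∃ n, 1 ≤ n ∧ ω.1 n = s := by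
    have h0 : ∀ᵐ w ∂(D.embeddedLaw s), ∃ n, 1 ≤ n ∧ w n = s := by
      rw [ae_iff, ← hs, ← embeddedLaw_forall_ne]
      congr 1
      ext w
      simp only [not_exists, not_and, Set.mem_ofPred_eq, Set.mem_iInter, avoiding]
      exact ⟨fun h _ k h1 _ => h k h1, fun h k h1 => h k k h1 le_rfl⟩
    exact (Measure.quasiMeasurePreserving_fst
      (ν := Measure.infinitePi fun _ : ℕ => expMeasure 1)).ae h0
  have hmeas (k : ℕ) : Measurable fun w : ℕ → S =>
      (avoiding s k).indicator (1 : (ℕ → S) → ℝ≥0∞) w * ENNReal.ofReal (D.rate (w k))⁻¹ :=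
    (measurable_one.indicator (measurableSet_avoiding s k)).mul
      ((measurable_of_countable fun y => ENNReal.ofReal (D.rate y)⁻¹).comp (measurable_pi_apply k))
  rw [lintegral_congr_ae (g := fun ω => ∑' k, ((avoiding s k).indicator 1 ω.1
      * ENNReal.ofReal (D.rate (ω.1 k))⁻¹) * ENNReal.ofReal (ω.2 k)) (by
    filter_upwards [hae, D.ae_holding_pos s] with ω h1 h2 using D.returnTime_eq_tsum h2 h1)]
  have hmeas' (k : ℕ) : Measurable fun ω : Sample S => ((avoiding s k).indicator 1 ω.1
      * ENNReal.ofReal (D.rate (ω.1 k))⁻¹) * ENNReal.ofReal (ω.2 k) :=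
    ((hmeas k).comp measurable_fst).mul (by fun_prop)
  rw [lintegral_tsum fun k => (hmeas' k).aemeasurable, ← ENNReal.tsum_mul_right]
  refine tsum_congr fun k => ?_
  rw [law, lintegral_prod_mul (f := fun w : ℕ → S => (avoiding s k).indicator 1 w
    * ENNReal.ofReal (D.rate (w k))⁻¹) (g := fun e : ℕ → ℝ => ENNReal.ofReal (e k))
    (hmeas k).aemeasurable (ENNReal.measurable_ofReal.comp (measurable_pi_apply k)).aemeasurable,
    D.lintegral_avoiding s s k fun y => ENNReal.ofReal (D.rate y)⁻¹]
  congr 1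
  exact (measurePreserving_eval_infinitePi (fun _ : ℕ => expMeasure 1) k).lintegral_comp
    (f := ENNReal.ofReal) (by fun_prop)

theorem positiveRecurrentAt_of_tsum_survival_ne_top {s : S} (h : ∑' n, D.survival s n s ≠ ∞) {r : ℝ}
    (hr : 0 < r) (hrate : ∀ x, r ≤ D.rate x) : D.PositiveRecurrentAt s := by
  have hs := D.escape_eq_zero_of_tsum_ne_top h
  refine ⟨(D.recurrentAt_iff s).2 hs, ?_⟩
  rw [D.lintegral_returnTime hs, lt_top_iff_ne_top]
  refine ENNReal.mul_ne_top (ne_top_of_le_ne_top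
    (ENNReal.mul_ne_top (a := ENNReal.ofReal r⁻¹) ENNReal.ofReal_ne_top h) ?_) expMean_ne_top
  rw [← ENNReal.tsum_mul_left]
  refine ENNReal.tsum_le_tsum fun n => ?_
  rw [survival, ← smul_eq_mul, ← Pi.smul_apply, ← iterate_killed_smul]
  refine D.iterate_killed_mono s n (fun y => ?_) s
  simp only [Pi.smul_apply, Pi.one_apply, smul_eq_mul, mul_one]
  exact ENNReal.ofReal_le_ofReal (inv_anti₀ hr (hrate y))

theorem nullRecurrentAt_of_tsum_survival_eq_top {s : S} (hs : D.escape s s = 0)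
    (h : ∑' n, D.survival s n s = ∞) {R : ℝ} (hrate : ∀ x, D.rate x ≤ R) :
    D.NullRecurrentAt s := by
  refine ⟨(D.recurrentAt_iff s).2 hs, ?_⟩
  have hR : 0 < R := (D.rate_pos s).trans_le (hrate s)
  rw [D.lintegral_returnTime hs, ENNReal.mul_eq_top]
  refine Or.inr ⟨top_le_iff.1 ?_, expMean_ne_zero⟩
  rw [← ENNReal.mul_top (a := ENNReal.ofReal R⁻¹) (by simpa using hR), ← h,
    ← ENNReal.tsum_mul_left]
  refine ENNReal.tsum_le_tsum fun n => ?_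
  rw [survival, ← smul_eq_mul, ← Pi.smul_apply, ← iterate_killed_smul]
  refine D.iterate_killed_mono s n (fun y => ?_) s
  simp only [Pi.smul_apply, Pi.one_apply, smul_eq_mul, mul_one]
  exact ENNReal.ofReal_le_ofReal (inv_anti₀ (D.rate_pos y) (hrate y))

end Law

end MarkovJump

/-! ### Weighted user counts -/

namespace NetState

variable {B : ℕ}

/-- The total number of users, where a user with link type `r` counts with weight `w r`. -/
def weight (w : Fin 2 → ℕ) (s : NetState B) : ℕ := ∑ i, ∑ r, w r * s i r

@[simp]
theorem weight_zero (w : Fin 2 → ℕ) : weight w (0 : NetState B) = 0 := by simp [weight]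

theorem weight_next_inl (w : Fin 2 → ℕ) (s : NetState B) (i : Fin B) (r : Fin 2) :
    weight w (s.next (Sum.inl (i, r))) = weight w s + w r := by
  simp only [weight, next]
  rw [← Finset.add_sum_erase _ _ (Finset.mem_univ i),
    ← Finset.add_sum_erase _ (fun j => ∑ r, w r * s j r) (Finset.mem_univ i),
    Finset.sum_congr rfl (s₁ := Finset.univ.erase i) (g := fun j => ∑ r, w r * s j r)
      fun j hj => by rw [Function.update_of_ne (Finset.ne_of_mem_erase hj)]]
  simp only [Function.update_self]
  fin_cases r <;> simp <;> ring

/-- Nonzero `s i r` is needed because truncated subtraction would otherwise leave the state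
unchanged. -/
theorem weight_next_inr (w : Fin 2 → ℕ) (s : NetState B) (i : Fin B) (r : Fin 2)
    (h : s i r ≠ 0) : weight w (s.next (Sum.inr (i, r))) + w r = weight w s := by
  obtain ⟨k, hk⟩ := Nat.exists_eq_succ_of_ne_zero h
  simp only [weight, next]
  rw [← Finset.add_sum_erase _ _ (Finset.mem_univ i),
    ← Finset.add_sum_erase _ (fun j => ∑ r, w r * s j r) (Finset.mem_univ i),
    Finset.sum_congr rfl (s₁ := Finset.univ.erase i) (g := fun j => ∑ r, w r * s j r)
      fun j hj => by rw [Function.update_of_ne (Finset.ne_of_mem_erase hj)]]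
  simp only [Function.update_self]
  fin_cases r <;> simp_all <;> ring

theorem weight_one_eq_zero_iff (s : NetState B) : weight 1 s = 0 ↔ s = 0 := by
  simp [weight, funext_iff]

end NetState

/-! ### Drift criteria for the network -/

namespace Network

variable {B : ℕ} (N : Network B) (π : Policy B)

theorem chain_jump_next_ne_zero {s : NetState B} {e : NetEvent B} (he : 0 < N.eventRate π s e) :
    (N.chain π).jump s (s.next e) ≠ 0 := by
  rw [← PMF.mem_support_iff]
  simp only [chain, PMF.support_map, Set.mem_image]
  refine ⟨e, ?_, rfl⟩
  rw [PMF.mem_support_iff]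
  simp only [eventLaw, PMF.ofFintype_apply, ne_eq, ENNReal.ofReal_eq_zero, not_le]
  exact div_pos he (N.totalRate_pos π s)

theorem exists_of_chain_jump_ne_zero {s t : NetState B} (h : (N.chain π).jump s t ≠ 0) :
    ∃ e, 0 < N.eventRate π s e ∧ s.next e = t := by
  rw [← PMF.mem_support_iff] at h
  simp only [chain, PMF.support_map, Set.mem_image] at h
  obtain ⟨e, he, rfl⟩ := h
  refine ⟨e, ?_, rfl⟩
  rw [PMF.mem_support_iff] at he
  simp only [eventLaw, PMF.ofFintype_apply, ne_eq, ENNReal.ofReal_eq_zero, not_le] at he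
  exact (div_pos_iff_of_pos_right (N.totalRate_pos π s)).1 he

theorem eventRate_inr_eq_zero {s : NetState B} {i : Fin B} {r : Fin 2} (h : s i r = 0) :
    N.eventRate π s (Sum.inr (i, r)) = 0 := by
  simp [eventRate, h]

theorem eventRate_inr_pos {s : NetState B} {i : Fin B} {r : Fin 2} (h : s i r ≠ 0) :
    0 < N.eventRate π s (Sum.inr (i, r)) := by
  have h1 : 0 < NetState.load s i := by
    unfold NetState.load; fin_cases r <;> simp at h ⊢ <;> omega
  have h2 : (0 : ℝ) < min (N.m i : ℝ) (NetState.load s i) :=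
    lt_min (by exact_mod_cast N.one_le_m i) (by exact_mod_cast h1)
  have h3 := N.dataRate_pos r
  have h4 := N.μ_pos
  have h5 : (0 : ℝ) < s i r := by exact_mod_cast Nat.pos_of_ne_zero h
  have h6 : (0 : ℝ) < NetState.load s i := by exact_mod_cast h1
  simp only [eventRate]
  positivity

/-- Mean of a function of the next state, in terms of the transition rates. -/
theorem tsum_chain_jump_mul (s : NetState B) (f : NetState B → ℕ) :
    ∑' t, (N.chain π).jump s t * (f t : ℝ≥0∞)
      = ENNReal.ofReal ((∑ e, N.eventRate π s e * f (s.next e)) / N.totalRate π s) := by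
  have h : ∑' t, (N.chain π).jump s t * (f t : ℝ≥0∞)
      = ∑ e, N.eventLaw π s e * (f (s.next e) : ℝ≥0∞) := by
    classical
    simp only [chain, PMF.map_apply, ← ENNReal.tsum_mul_right]
    rw [ENNReal.tsum_comm, tsum_fintype]
    refine Finset.sum_congr rfl fun e _ => ?_
    rw [tsum_eq_single (s.next e) fun t ht => by simp [ht]]
    simp
  rw [h, Finset.sum_div, ENNReal.ofReal_sum_of_nonneg fun e _ => div_nonneg
    (mul_nonneg (N.eventRate_nonneg π s e) (Nat.cast_nonneg _)) (N.totalRate_pos π s).le]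
  refine Finset.sum_congr rfl fun e _ => ?_
  rw [mul_div_right_comm, ENNReal.ofReal_mul (div_nonneg (N.eventRate_nonneg π s e)
    (N.totalRate_pos π s).le), ENNReal.ofReal_natCast]
  rfl

/-- The drift of the weighted number of users. -/
theorem sum_eventRate_mul_weight (w : Fin 2 → ℕ) (s : NetState B) :
    ∑ e, N.eventRate π s e * (NetState.weight w (s.next e) : ℝ)
      = N.totalRate π s * NetState.weight w s
        + N.lam * ∑ i, ∑ r, N.joinProb π s i r * w r
        - N.μ * ∑ i, ∑ r, w r *
          (s i r * (min (N.m i : ℝ) (NetState.load s i) * N.dataRate r / NetState.load s i)) := by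
  have hinl (i : Fin B) (r : Fin 2) :
      N.eventRate π s (Sum.inl (i, r)) * (NetState.weight w (s.next (Sum.inl (i, r))) : ℝ)
        = N.eventRate π s (Sum.inl (i, r)) * NetState.weight w s
          + N.lam * (N.joinProb π s i r * w r) := by
    rw [NetState.weight_next_inl]; simp only [eventRate]; push_cast; ring
  have hinr (i : Fin B) (r : Fin 2) :
      N.eventRate π s (Sum.inr (i, r)) * (NetState.weight w (s.next (Sum.inr (i, r))) : ℝ)
        = N.eventRate π s (Sum.inr (i, r)) * NetState.weight w s
          - N.μ * (w r * (s i r * (min (N.m i : ℝ) (NetState.load s i) * N.dataRate r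
            / NetState.load s i))) := by
    by_cases h : s i r = 0
    -- Departures from an empty class have rate zero, so truncation does no harm.
    · simp [N.eventRate_inr_eq_zero π h, h]
    · rw [← NetState.weight_next_inr w s i r h]; simp only [eventRate]; push_cast; ring
  rw [totalRate, Fintype.sum_sum_type, Fintype.sum_sum_type, Fintype.sum_prod_type,
    Fintype.sum_prod_type, Fintype.sum_prod_type, Fintype.sum_prod_type]
  simp only [hinl, hinr, Finset.sum_add_distrib, Finset.sum_sub_distrib, ← Finset.sum_mul,
    ← Finset.mul_sum]
  ring

theorem dataRate_zero : N.dataRate 0 = N.c₁ := if_pos rfl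

theorem dataRate_one : N.dataRate 1 = N.c₂ := if_neg one_ne_zero

theorem lam_le_totalRate (s : NetState B) : N.lam ≤ N.totalRate π s := by
  rw [totalRate_eq]
  have h1 := N.c₁_pos
  have h2 := h1.trans N.c₁_lt_c₂
  have h3 := N.μ_pos
  exact le_add_of_nonneg_right (Finset.sum_nonneg fun i _ => by positivity)

theorem totalRate_le (s : NetState B) :
    N.totalRate π s ≤ N.lam + ∑ i, N.μ * N.m i * N.c₂ := by
  rw [totalRate_eq]
  have h1 := N.c₁_pos
  have h2 := h1.trans N.c₁_lt_c₂
  have h3 := N.μ_pos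
  gcongr with i
  · exact min_le_left _ _
  · refine div_le_of_le_mul₀ (by positivity) h2.le ?_
    have := mul_le_mul_of_nonneg_left N.c₁_lt_c₂.le (Nat.cast_nonneg (α := ℝ) (s i 0))
    simp only [NetState.load]; push_cast; linarith

/-- From every nonempty state a departure leads to a state with one user less. -/
theorem exists_departure {s : NetState B} (hs : s ≠ 0) :
    ∃ t, (N.chain π).jump s t ≠ 0 ∧ NetState.weight 1 t + 1 = NetState.weight 1 s := by
  obtain ⟨i, r, h⟩ : ∃ i r, s i r ≠ 0 := by
    by_contra! h
    exact hs (funext fun i => funext fun r => h i r)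
  exact ⟨_, N.chain_jump_next_ne_zero π (N.eventRate_inr_pos π h),
    NetState.weight_next_inr 1 s i r h⟩

theorem reaches_zero (s : NetState B) : (N.chain π).Reaches s 0 := by
  induction h : NetState.weight 1 s generalizing s with
  | zero => rw [(NetState.weight_one_eq_zero_iff s).1 h]; exact Relation.ReflTransGen.refl
  | succ n ih =>
    have hs : s ≠ 0 := fun h0 => by simp [h0] at h
    obtain ⟨t, ht, hw⟩ := N.exists_departure π hs
    exact Relation.ReflTransGen.head ht (ih t (by omega))

/-- The empty state is visited before the return to `s` with positive probability. -/
theorem exists_iterate_killed_ne_zero {g : NetState B → ℝ≥0∞} (hg : g 0 ≠ 0) (s : NetState B) :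
    ∃ j, ((N.chain π).killed s)^[j] g s ≠ 0 := by
  -- Emptying the network by departures visits only states with fewer users than `s`, so `s` is not
  -- met again.
  suffices h : ∀ n, ∀ t : NetState B, NetState.weight 1 t = n →
      n ≤ NetState.weight 1 s → ∃ j, ((N.chain π).killed s)^[j] g t ≠ 0 from h _ s rfl le_rfl
  intro n
  induction n with
  | zero =>
    intro t ht _
    rw [(NetState.weight_one_eq_zero_iff t).1 ht]
    exact ⟨0, hg⟩
  | succ n ih =>
    intro t ht hn
    have ht0 : t ≠ 0 := fun h0 => by simp [h0] at ht
    obtain ⟨u, hu, hw⟩ := N.exists_departure π ht0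
    obtain ⟨j, hj⟩ := ih u (by omega) (by omega)
    have hus : u ≠ s := fun h => by rw [h] at hw; omega
    refine ⟨j + 1, fun h0 => ?_⟩
    rw [Function.iterate_succ_apply'] at h0
    have := ((N.chain π).mul_le_killed hus (((N.chain π).killed s)^[j] g) (x := t)).trans_eq h0
    simp [hu, hj] at this

/-- Instability: a weighted number of users with nonnegative drift, positive in the empty state. -/
theorem unstable_of_drift {w : Fin 2 → ℕ}
    (h0 : 0 < ∑ i, ∑ r, N.joinProb π 0 i r * w r)
    (hdrift : ∀ s : NetState B, N.μ * ∑ i, ∑ r, w r *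
        (s i r * (min (N.m i : ℝ) (NetState.load s i) * N.dataRate r / NetState.load s i))
      ≤ N.lam * ∑ i, ∑ r, N.joinProb π s i r * w r) :
    N.Unstable π := by
  have htop (s : NetState B) : ∑' n, (N.chain π).survival s n s = ∞ := by
    -- The drift per jump at the empty state, where only arrivals occur.
    set a : ℝ := N.lam * (∑ i, ∑ r, N.joinProb π 0 i r * w r) / N.totalRate π 0 with ha
    have hapos : 0 < a := div_pos (mul_pos N.lam_pos h0) (N.totalRate_pos π 0)
    set g : NetState B → ℝ≥0∞ := ({0} : Set (NetState B)).indicator fun _ => ENNReal.ofReal a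
    obtain ⟨j, hj⟩ := N.exists_iterate_killed_ne_zero π (g := g) (by simpa [g] using hapos) s
    refine (N.chain π).tsum_survival_eq_top_of_drift (c := ((w 0 + w 1 : ℕ) : ℝ≥0∞))
      (V := fun s => (NetState.weight w s : ℝ≥0∞)) (ENNReal.natCast_ne_top _)
      (fun _ => ENNReal.natCast_ne_top _) (fun x => ?_) (fun x y hxy => ?_) hj
    · rw [N.tsum_chain_jump_mul π x, N.sum_eventRate_mul_weight π w x]
      by_cases hx : x = 0
      · subst hx
        simp [g, ha]
      · rw [show g x = 0 from Set.indicator_of_notMem (mt Set.mem_singleton_iff.1 hx) _, add_zero, ← ENNReal.ofReal_natCast]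
        refine ENNReal.ofReal_le_ofReal ?_
        rw [le_div_iff₀ (N.totalRate_pos π x)]
        linarith [hdrift x]
    · obtain ⟨e, he, rfl⟩ := N.exists_of_chain_jump_ne_zero π hxy
      norm_cast
      rcases e with ⟨i, r⟩ | ⟨i, r⟩
      · rw [NetState.weight_next_inl]
        fin_cases r <;> simp
      · have hr : x i r ≠ 0 := fun h => by rw [N.eventRate_inr_eq_zero π h] at he; exact he.false
        have := NetState.weight_next_inr w x i r hr
        omega
  by_cases hrec : ∃ s ∈ N.stateSpace π, (N.chain π).escape s s = 0
  · obtain ⟨s, -, hs⟩ := hrec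
    refine Or.inl fun t ht => ?_
    exact (N.chain π).nullRecurrentAt_of_tsum_survival_eq_top
      ((N.chain π).escape_eq_zero_of_recurrent hs ((N.reaches_zero π s).trans ht)) (htop t)
      (N.totalRate_le π)
  · push Not at hrec
    exact Or.inr fun t ht => ((N.chain π).transientAt_iff t).2 (hrec t ht)

/-- Stability: the total service rate of every nonempty state is at least a constant that exceeds
the arrival rate. -/
theorem stable_of_lam_lt {d : ℝ} (hd : N.lam < d)
    (hserv : ∀ s : NetState B, s ≠ 0 → N.lam + d ≤ N.totalRate π s) : N.Stable π := by
  intro s hs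
  have hl := N.lam_pos
  -- With total rate `R ≥ λ + d`, the drift per jump is `2 * λ / R - 1 ≤ -ε`. At the empty state it
  -- is `+1`, whence `b = 1 + ε`.
  set ε : ℝ := (d - N.lam) / (d + N.lam) with hε
  have hεpos : 0 < ε := div_pos (by linarith) (by linarith)
  refine (N.chain π).positiveRecurrentAt_of_tsum_survival_ne_top ?_ hl (N.lam_le_totalRate π)
  refine (N.chain π).tsum_survival_ne_top_of_drift (z := 0) (ε := ENNReal.ofReal ε)
    (b := ENNReal.ofReal (1 + ε))
    (V := fun s => (NetState.weight 1 s : ℝ≥0∞)) hs (fun _ => ENNReal.natCast_ne_top _)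
    (by simpa using hεpos) ENNReal.ofReal_ne_top (fun x => ?_) s
  have harr : ∑ i, ∑ r, N.joinProb π x i r * ((1 : Fin 2 → ℕ) r : ℝ) = 1 := by
    simpa using N.sum_joinProb π x
  have hdep : N.μ * ∑ i, ∑ r, ((1 : Fin 2 → ℕ) r : ℝ) *
      (x i r * (min (N.m i : ℝ) (NetState.load x i) * N.dataRate r / NetState.load x i))
      = N.totalRate π x - N.lam := by
    have h1 : ∑ i, ∑ r, N.eventRate π x (Sum.inl (i, r)) = N.lam := by
      simp only [eventRate, ← Finset.mul_sum, N.sum_joinProb, mul_one]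
    rw [totalRate, Fintype.sum_sum_type, Fintype.sum_prod_type, Fintype.sum_prod_type, h1]
    simp [eventRate, Finset.mul_sum, mul_add]
  have hR := N.totalRate_pos π x
  rw [N.tsum_chain_jump_mul π x, N.sum_eventRate_mul_weight π 1 x, harr, hdep,
    ← ENNReal.ofReal_natCast]
  set W : ℝ := (NetState.weight 1 x : ℝ) with hW
  have hW0 : 0 ≤ W := Nat.cast_nonneg _
  set R : ℝ := N.totalRate π x
  by_cases hx : x = 0
  · have hRl : R = N.lam := by
      simp only [R, totalRate_eq]
      simp [hx, NetState.load]
    rw [Set.indicator_of_mem (by simpa using hx), Pi.one_apply,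
      mul_one (ENNReal.ofReal _), ← ENNReal.ofReal_add hW0 (by linarith), hRl]
    have h1 : (N.lam * W + N.lam * 1 - (N.lam - N.lam)) / N.lam = W + 1 := by field_simp; ring
    rw [h1, ← ENNReal.ofReal_add (by positivity) hεpos.le]
    exact ENNReal.ofReal_le_ofReal (by linarith)
  · rw [Set.indicator_of_notMem (by simpa using hx), mul_zero, add_zero]
    have hRd := hserv x hx
    have hW1 : 1 ≤ W := by
      rw [hW, Nat.one_le_cast, Nat.one_le_iff_ne_zero, Ne, NetState.weight_one_eq_zero_iff]
      exact hx
    have hle : R * W + N.lam * 1 - (R - N.lam) ≤ (W - ε) * R := by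
      have : ε * R ≤ R - 2 * N.lam := by
        rw [hε, div_mul_eq_mul_div, div_le_iff₀ (by linarith)]
        nlinarith
      linarith
    have hnn : 0 ≤ (R * W + N.lam * 1 - (R - N.lam)) / R :=
      div_nonneg (by nlinarith) hR.le
    rw [← ENNReal.ofReal_add hnn hεpos.le]
    refine ENNReal.ofReal_le_ofReal ?_
    have := (div_le_iff₀ hR).2 hle
    linarith

theorem sum_toReal_eq_one {B : ℕ} (q : PMF (Fin B)) : ∑ i, (q i).toReal = 1 := by
  rw [← ENNReal.toReal_sum fun i _ => PMF.apply_ne_top _ _, ← tsum_fintype (L := .unconditional _),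
    PMF.tsum_coe, ENNReal.toReal_one]

theorem p_le_iSup (i : Fin B) : N.p i ≤ ⨆ i, N.p i :=
  le_ciSup (Set.finite_range N.p).bddAbove i

theorem iSup_p_le_one (hB : 0 < B) : ⨆ i, N.p i ≤ 1 := by
  have : Nonempty (Fin B) := ⟨⟨0, hB⟩⟩
  refine ciSup_le fun i => ?_
  rw [← N.p_sum]
  exact Finset.single_le_sum (f := N.p) (fun j _ => N.p_nonneg j) (Finset.mem_univ i)

/-- Under the Load based policy a user is served by the BS of its own cell with probability at most
`max p`. -/
theorem sum_joinProb_one_le (s : NetState B) :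
    ∑ i, N.joinProb (loadBased B) s i 1 ≤ ⨆ i, N.p i := by
  rcases Nat.eq_zero_or_pos B with rfl | hB
  · simp
  -- The choice of BS does not depend on the cell, so any fixed cell serves as the argument.
  let k₀ : Fin B := ⟨0, hB⟩
  calc ∑ i, N.joinProb (loadBased B) s i 1
      = ∑ i, N.p i * (loadBased B s k₀ i).toReal := by
        refine Finset.sum_congr rfl fun i _ => ?_
        rw [joinProb, Finset.sum_eq_single i (fun k _ hk => by simp [linkType, hk])
          (fun h => absurd (Finset.mem_univ i) h)]
        simp [linkType, loadBased]
    _ ≤ ∑ i, (⨆ i, N.p i) * (loadBased B s k₀ i).toReal :=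
        Finset.sum_le_sum fun i _ =>
          mul_le_mul_of_nonneg_right (N.p_le_iSup i) ENNReal.toReal_nonneg
    _ = ⨆ i, N.p i := by rw [← Finset.mul_sum, sum_toReal_eq_one, mul_one]

end Network

/-! ### The two claims on the Load based policy -/

theorem mainTheorem3 {B : ℕ} (hB : 2 ≤ B) (N : Network B) (hc₁ : N.c₁ = 1) (hc₂ : N.c₂ = 2) :
    (2 * N.μ * (∑ i, (N.m i : ℝ)) / (2 - ⨆ i, N.p i) ≤ N.lam → N.Unstable (loadBased B)) ∧
    ((∀ i, N.m i = 1) → N.lam < N.μ → N.Stable (loadBased B)) := by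
  have hpmax := N.iSup_p_le_one (by omega)
  have hμ := N.μ_pos
  refine ⟨fun hlam => ?_, fun hm hlam => ?_⟩
  · have hwork (s : NetState B) : 2 - ⨆ i, N.p i
        ≤ ∑ i, ∑ r, N.joinProb (loadBased B) s i r * ((![2, 1] : Fin 2 → ℕ) r : ℝ) := by
      have h1 := N.sum_joinProb (loadBased B) s
      have h2 := N.sum_joinProb_one_le s
      simp only [Fin.sum_univ_two, Finset.sum_add_distrib] at h1
      simp only [Fin.sum_univ_two, Matrix.cons_val_zero, Matrix.cons_val_one, Nat.cast_ofNat,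
        Nat.cast_one, mul_one, Finset.sum_add_distrib, ← Finset.sum_mul]
      linarith
    refine N.unstable_of_drift _ (w := ![2, 1]) (by linarith [hwork 0]) fun s => ?_
    rw [div_le_iff₀ (by linarith)] at hlam
    refine le_trans ?_ (hlam.trans (mul_le_mul_of_nonneg_left (hwork s) N.lam_pos.le))
    rw [mul_comm 2 N.μ, mul_assoc, Finset.mul_sum _ _ (2 : ℝ)]
    refine mul_le_mul_of_nonneg_left (Finset.sum_le_sum fun i _ => ?_) hμ.le
    set L : ℝ := (NetState.load s i : ℝ) with hL
    have hsum : (s i 0 : ℝ) + s i 1 = L := by simp [hL, NetState.load]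
    -- Weight times rate is 2 for both types. The factor `L / L` is kept because it is 0 at load
    -- zero.
    calc _ = 2 * (min (N.m i : ℝ) L * (L / L)) := by
          simp only [Fin.sum_univ_two, Matrix.cons_val_zero, Matrix.cons_val_one, Nat.cast_ofNat,
            Nat.cast_one, N.dataRate_zero, N.dataRate_one, hc₁, hc₂]
          rw [← hsum]; ring
      _ ≤ 2 * (N.m i * 1) := by
          gcongr
          · exact min_le_left _ _
          · exact div_self_le_one L
      _ = 2 * N.m i := by ring
  · refine N.stable_of_lam_lt _ hlam fun s hs => ?_
    rw [N.totalRate_eq, hc₁, hc₂]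
    gcongr
    -- A single busy BS suffices: each of its users has rate at least 1, so it serves at total rate
    -- at least `μ`.
    have : ∃ i, 0 < NetState.load s i := by
      by_contra! h
      refine hs (funext fun i => funext fun r => ?_)
      have := h i
      unfold NetState.load at this
      fin_cases r <;> simp <;> omega
    obtain ⟨i, hi⟩ := this
    have hi' : (1 : ℝ) ≤ NetState.load s i := by exact_mod_cast hi
    refine le_trans ?_ (Finset.single_le_sum (fun j _ => by positivity) (Finset.mem_univ i))
    rw [hm i, Nat.cast_one, min_eq_left hi', mul_one]
    refine le_mul_of_one_le_right hμ.le ?_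
    rw [one_le_div (by linarith)]
    simp only [NetState.load]
    push_cast
    have := Nat.cast_nonneg (α := ℝ) (s i 1)
    linarith
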